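/- Let $d\ge 1$ and $n_1,\dots,n_d\ge 1$ be integers. An index is a tuple $\alpha=(\alpha_1,\dots,\alpha_d)$ with $1\le\alpha_i\le n_i$ for all $i$; for indices $\alpha,\beta$ let $\alpha\wedge\beta$ and $\alpha\vee\beta$ be the entrywise minimum and maximum. Let $\mathbb{R}[\mathbf{x}]$ be the polynomial ring in one variable $x_\alpha$ for every index $\alpha$. Order the variables by $x_{1\ldots 11}>x_{1\ldots 12}>\dots>x_{n_1n_2\ldots n_d}$ (that is, $x_\alpha>x_\beta$ if and only if $\alpha$ precedes $\beta$ lexicographically) and the monomials by the corresponding graded reverse lexicographic (grevlex) order: $\mathbf{x}^{u}>\mathbf{x}^{v}$ if and only if $|u|>|v|$, or $|u|=|v|$ and, with the variables listed in decreasing order, the rightmost nonzero entry of $u-v$ is negative. Put $$f_d^{(\alpha,\beta)}=-x_{\alpha\wedge\beta}\,x_{\alpha\vee\beta}+x_\alpha x_\beta,\qquad g_d=\sum_{\alpha}x_\alpha^2-1 ,$$ where the sum is over all indices. For $S\subseteq[d]=\{1,\dots,d\}$ with $2\le|S|\le d$ let $\mathcal{P}_S$ be the collection of all nonempty $M\subseteq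 S$ such that - $|M|\le\lfloor |S|/2\rfloor$, if $|S|$ is odd; - $|M|\le\lfloor(|S|-1)/2\rfloor$, or $|M|=|S|/2$ and $\min S\in M$, if $|S|$ is even. For $M\in\mathcal{P}_S$ let $\mathcal{T}_d^{S,M}$ be the set of all pairs of indices $(\alpha,\beta)$ with $\alpha_i=\beta_i$ for $i\notin S$, $\alpha_j>\beta_j$ for $j\in M$, and $\alpha_k<\beta_k$ for $k\in S\setminus M$. Let $$\mathcal{G}_d=\bigcup_{S\subseteq[d],\ 2\le|S|\le d}\ \bigcup_{M\in\mathcal{P}_S}\{f_d^{(\alpha,\beta)}:(\alpha,\beta)\in\mathcal{T}_d^{S,M}\}\ \cup\ \{g_d\},\qquad J_d=\langle\mathcal{G}_d\rangle .$$ **Theorem.** The set $\mathcal{G}_d$ is the reduced Gröbner basis of the ideal $J_d$ with respect to the grevlex order. Here a finite set $\mathcal{G}$ of nonzero polynomials that generates an ideal $J$ is a Gröbner basis of $J$ if every polynomial $f$ can be written as $f=g+r$ with $g\in J$ and a unique polynomial $r$ none of whose monomials is divisible by the leading monomial of an element of $\mathcal{G}$. It is the reduced Gröbner basis if moreover every element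 of $\mathcal{G}$ has leading coefficient $1$ and no monomial of an element $h\in\mathcal{G}$ is divisible by the leading monomial of an element of $\mathcal{G}\setminus\{h\}$. -/

import Mathlib

open scoped MonomialOrder

/-! ### The graded reverse lexicographic order -/

/-- Exponent vectors, to be ordered by the graded reverse lexicographic order. -/
def GrevLex (σ : Type*) := σ →₀ ℕ

namespace GrevLex

variable {σ : Type*}

noncomputable instance : AddCommMonoid (GrevLex σ) :=
  inferInstanceAs (AddCommMonoid (σ →₀ ℕ))

/-- The sorting key: first the total degree, then the reversed colexicographic order. -/
noncomputable def key (a : σ →₀ ℕ) : ℕ ×ₗ (Colex (σ →₀ ℕ))ᵒᵈ :=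
  toLex (a.degree, OrderDual.toDual (toColex a))

theorem key_injective : Function.Injective (key (σ := σ)) := by
  intro a b h
  have h2 := congrArg (fun p => (ofLex p).2) h
  exact toColex_inj.mp (OrderDual.toDual.injective h2)

variable [LinearOrder σ]

noncomputable instance : LinearOrder (GrevLex σ) :=
  LinearOrder.lift' (fun a : GrevLex σ => key (σ := σ) a) key_injective

theorem le_iff_key {a b : σ →₀ ℕ} :
    @LE.le (GrevLex σ) _ a b ↔
      a.degree < b.degree ∨ (a.degree = b.degree ∧ toColex b ≤ toColex a) :=
  Prod.Lex.toLex_le_toLex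

theorem lt_iff_key {a b : σ →₀ ℕ} :
    @LT.lt (GrevLex σ) _ a b ↔
      a.degree < b.degree ∨ (a.degree = b.degree ∧ toColex b < toColex a) :=
  Prod.Lex.toLex_lt_toLex

instance : IsOrderedAddMonoid (GrevLex σ) where
  add_le_add_left a b h c := by
    change @LE.le (GrevLex σ) _ (show σ →₀ ℕ from a) (show σ →₀ ℕ from b) at h
    change @LE.le (GrevLex σ) _ ((show σ →₀ ℕ from a) + (show σ →₀ ℕ from c))
      ((show σ →₀ ℕ from b) + (show σ →₀ ℕ from c))
    rw [le_iff_key] at h ⊢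
    rcases h with h | ⟨h1, h2⟩
    · left
      rw [map_add, map_add]
      exact Nat.add_lt_add_right h _
    · right
      refine ⟨by rw [map_add, map_add, h1], ?_⟩
      rw [toColex_add, toColex_add]
      exact add_le_add_left h2 _

theorem le_of_le {a b : σ →₀ ℕ} (h : a ≤ b) : @LE.le (GrevLex σ) _ a b := by
  rw [le_iff_key]
  rcases (Finsupp.degree_mono h).lt_or_eq with h1 | h1
  · exact Or.inl h1
  · right
    refine ⟨h1, ?_⟩
    have hb : a + (b - a) = b := add_tsub_cancel_of_le h
    have hd : (b - a).degree = 0 := by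
      have := congrArg Finsupp.degree hb
      rw [map_add] at this
      omega
    rw [Finsupp.degree_eq_zero_iff] at hd
    rw [hd, add_zero] at hb
    rw [hb]

instance [Finite σ] : WellFoundedLT (GrevLex σ) := by
  have : WellQuasiOrderedLE (GrevLex σ) := ⟨fun f => by
    obtain ⟨m, n, hmn, h⟩ := wellQuasiOrdered_le (α := σ →₀ ℕ) f
    exact ⟨m, n, hmn, le_of_le h⟩⟩
  infer_instance

end GrevLex

/-- The graded reverse lexicographic order on the monomials in finitely many variables `x_s`,
`s : σ`, where the variables are ordered so that `x_s > x_t` if and only if `s < t`. -/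
noncomputable def grevlex (σ : Type*) [LinearOrder σ] [Finite σ] : MonomialOrder σ where
  syn := GrevLex σ
  toSyn := { toEquiv := (Equiv.refl _ : (σ →₀ ℕ) ≃ GrevLex σ), map_add' := fun _ _ => rfl }
  toSyn_monotone _ _ h := GrevLex.le_of_le h

/-- `x^b > x^a` in the graded reverse lexicographic order if and only if `|b| > |a|`, or `|b| = |a|`
and the rightmost nonzero entry of `b - a` is negative. -/
theorem grevlex_lt_iff {σ : Type*} [LinearOrder σ] [Finite σ] {a b : σ →₀ ℕ} :
    a ≺[grevlex σ] b ↔ a.degree < b.degree ∨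
      (a.degree = b.degree ∧ ∃ s, (b s : ℤ) - a s < 0 ∧ ∀ t, s < t → (b t : ℤ) - a t = 0) := by
  have key : a ≺[grevlex σ] b ↔
      a.degree < b.degree ∨ (a.degree = b.degree ∧ toColex b < toColex a) :=
    GrevLex.lt_iff_key (a := a) (b := b)
  rw [key, Finsupp.Colex.lt_iff]
  refine or_congr Iff.rfl (and_congr Iff.rfl (exists_congr fun s => ?_))
  constructor
  · rintro ⟨h1, h2⟩
    refine ⟨?_, fun t ht => ?_⟩
    · have : b s < a s := h2
      omega
    · have : b t = a t := h1 t ht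
      omega
  · rintro ⟨h1, h2⟩
    refine ⟨fun t ht => ?_, ?_⟩
    · have := h2 t ht
      change b t = a t
      omega
    · change b s < a s
      omega

/-! ### Gröbner bases -/

/-- `G` is a Gröbner basis of the ideal `J` with respect to the monomial order `m`: it is a finite
generating set of `J`, consisting of nonzero polynomials, and every polynomial `f` can be written as
`f = g + r` with `g ∈ J` and a unique `r` no monomial of which is divisible by the leading monomial
of an element of `G`. -/
structure IsGroebnerBasis {σ K : Type*} [Field K] (m : MonomialOrder σ)
    (G : Set (MvPolynomial σ K)) (J : Ideal (MvPolynomial σ K)) : Prop where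
  finite : G.Finite
  zero_notMem : (0 : MvPolynomial σ K) ∉ G
  span_eq : Ideal.span G = J
  existsUnique_remainder : ∀ f : MvPolynomial σ K, ∃! r : MvPolynomial σ K,
    (∃ g ∈ J, f = g + r) ∧ ∀ u ∈ r.support, ∀ h ∈ G, ¬ m.degree h ≤ u

/-- `G` is the reduced Gröbner basis of `J`: a Gröbner basis all of whose elements have leading
coefficient `1`, such that no monomial of an element `g` of `G` is divisible by the leading monomial
of another element, that is, no monomial of `g` lies in the ideal generated by the leading terms of
`G \ {g}`. -/
structure IsReducedGroebnerBasis {σ K : Type*} [Field K] (m : MonomialOrder σ)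
    (G : Set (MvPolynomial σ K)) (J : Ideal (MvPolynomial σ K)) : Prop
    extends IsGroebnerBasis m G J where
  leadingCoeff_eq_one : ∀ g ∈ G, m.leadingCoeff g = 1
  reduced : ∀ g ∈ G, ∀ h ∈ G, h ≠ g → ∀ u ∈ g.support, ¬ m.degree h ≤ u

/-! ### The polynomials attached to tensors of order `d` -/

namespace TensorIdeal

variable {d : ℕ}

/-- Indices `α = (α_1, …, α_d)` of the entries of an `n_1 × ⋯ × n_d` tensor. The order on this type,
and `⊓` and `⊔`, are entrywise. -/
abbrev Index (n : Fin d → ℕ) := (i : Fin d) → Fin (n i)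

/-- The index set of the variables. It carries the lexicographic order, so that
`x_{1…11} > x_{1…12} > ⋯ > x_{n_1…n_d}` in `grevlex (VarIndex n)`. -/
abbrev VarIndex (n : Fin d → ℕ) := Lex (Index n)

/-- The ring `ℝ[x]`, with one variable for each entry of the tensor. -/
abbrev PolyRing (n : Fin d → ℕ) := MvPolynomial (VarIndex n) ℝ

/-- The variable `x_α`. -/
noncomputable def x {n : Fin d → ℕ} (α : Index n) : PolyRing n := MvPolynomial.X (toLex α)

/-- The binomial `f_d^{(α,β)} = - x_{α ∧ β} x_{α ∨ β} + x_α x_β`. -/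
noncomputable def f {n : Fin d → ℕ} (α β : Index n) : PolyRing n :=
  -(x (α ⊓ β) * x (α ⊔ β)) + x α * x β

/-- The polynomial `g_d = ∑_α x_α² - 1`. -/
noncomputable def g (n : Fin d → ℕ) : PolyRing n := (∑ α : Index n, x α ^ 2) - 1

/-- The collection `𝒮_{[d]}` of the subsets of `[d]` with at least two elements. -/
def diffSets (d : ℕ) : Set (Finset (Fin d)) := {S | 2 ≤ S.card ∧ S.card ≤ d}

/-- The collection `𝒫_S` of switch sets. In the even case a set with exactly half of the elements
of `S` has to contain the smallest element of `S`. -/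
def switchSets (S : Finset (Fin d)) : Set (Finset (Fin d)) :=
  if Odd S.card then
    {M | M ⊆ S ∧ M.card ≤ S.card / 2} \ {∅}
  else
    ({M | M ⊆ S ∧ M.card ≤ (S.card - 1) / 2} ∪
      {M | M ⊆ S ∧ M.card = S.card / 2 ∧ ∃ e ∈ M, IsLeast (S : Set (Fin d)) e}) \ {∅}

/-- The set `𝒯_d^{S,M}` of pairs of indices. -/
def pairs (n : Fin d → ℕ) (S M : Finset (Fin d)) : Set (Index n × Index n) :=
  {p | (∀ i, i ∉ S → p.1 i = p.2 i) ∧ (∀ j ∈ M, p.2 j < p.1 j) ∧ ∀ k ∈ S \ M, p.1 k < p.2 k}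

/-- The set `{f_d^S}`. -/
def binomials (n : Fin d → ℕ) (S : Finset (Fin d)) : Set (PolyRing n) :=
  ⋃ M ∈ switchSets S, {q | ∃ p ∈ pairs n S M, q = f p.1 p.2}

/-- The set `𝒢_d`. -/
def G (n : Fin d → ℕ) : Set (PolyRing n) := (⋃ S ∈ diffSets d, binomials n S) ∪ {g n}

/-- The ideal `J_d` generated by `𝒢_d`. -/
noncomputable def J (n : Fin d → ℕ) : Ideal (PolyRing n) := Ideal.span (G n)

end TensorIdeal

/-! The sets `S`, `M` merely enumerate unordered pairs, so `G n` consists of `g n` and all `f α β`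
with `α`, `β` incomparable (`G_eq`). Their leading monomials are `x_α x_β` (`degree_f`) and `x_o²`
with `o = (1, …, 1)` (`degree_g`). Hence a reduced monomial is supported on a chain and is not
divisible by `x_o²`.

Remainders exist by division. For uniqueness, a reduced `r ∈ J n` must vanish (`eq_zero_of_mem_J`).
Instead of S-pairs, the proof uses the Segre map `x_α ↦ t ∏ y_{i, α_i}`. It kills the binomials and
is injective on chain monomials (`injOn_linearCombination_segreExp`). If `r = p + a g` with `p` in
the binomial ideal, reducing `a` to a chain-supported `c` shows that `r` and `c g` have the same
image. For lex on the target, the image of `g` leads with that of `x_o²`, so the leading monomial of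
the common image comes from `x^u x_o²` for some `u` in the support of `c`. This is again a chain, as
`o` lies below every index. By injectivity it is a monomial of `r`, a contradiction
(`eq_zero_of_mem_sup_span_singleton`). -/

open MvPolynomial

/-! ### Monomial maps, and division by monic polynomials. -/

section Toric

variable {σ τ ι K : Type*} [Field K]

/-- The homomorphism of polynomial rings that sends the variable `X s` to the monomial with
exponent `e s`. -/
noncomputable def monomialHom (K : Type*) [Field K] (e : σ → τ →₀ ℕ) :
    MvPolynomial σ K →ₐ[K] MvPolynomial τ K :=
  aeval fun s => monomial (e s) 1

theorem monomialHom_monomial (e : σ → τ →₀ ℕ) (u : σ →₀ ℕ) (c : K) :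
    monomialHom K e (monomial u c) = monomial (Finsupp.linearCombination ℕ e u) c := by
  rw [monomialHom, aeval_monomial, Finsupp.linearCombination_apply, Finsupp.sum,
    ← mul_one c, ← C_mul_monomial, monomial_sum_one, Finsupp.prod, mul_one]
  simp [monomial_pow, algebraMap_eq]

theorem monomialHom_eq_sum (e : σ → τ →₀ ℕ) (p : MvPolynomial σ K) :
    monomialHom K e p =
      ∑ u ∈ p.support, monomial (Finsupp.linearCombination ℕ e u) (coeff u p) := by
  conv_lhs => rw [p.as_sum]
  simp_rw [map_sum, monomialHom_monomial]

theorem exists_of_mem_support_monomialHom {e : σ → τ →₀ ℕ} {p : MvPolynomial σ K} {v : τ →₀ ℕ}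
    (hv : v ∈ (monomialHom K e p).support) :
    ∃ u ∈ p.support, Finsupp.linearCombination ℕ e u = v := by
  classical
  by_contra! h
  rw [mem_support_iff, monomialHom_eq_sum, coeff_sum] at hv
  exact hv (Finset.sum_eq_zero fun u hu => by rw [coeff_monomial, if_neg (h u hu)])

theorem coeff_monomialHom {e : σ → τ →₀ ℕ} {p : MvPolynomial σ K}
    (hp : Set.InjOn (Finsupp.linearCombination ℕ e) (p.support : Set (σ →₀ ℕ)))
    {u : σ →₀ ℕ} (hu : u ∈ p.support) :
    coeff (Finsupp.linearCombination ℕ e u) (monomialHom K e p) = coeff u p := by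
  classical
  rw [monomialHom_eq_sum, coeff_sum, Finset.sum_eq_single u]
  · simp
  · intro v hv hvu
    rw [coeff_monomial, if_neg fun h => hvu (hp hv hu h)]
  · exact fun h => absurd hu h

/-- If a monomial map is injective on a set `C` of exponents to which polynomials can be reduced
modulo an ideal `I` in its kernel, then `I + (g)` contains no nonzero polynomial supported on
the elements of `C` not above `w`, where `w` gives the leading monomial of the image of `g`. -/
theorem eq_zero_of_mem_sup_span_singleton (m : MonomialOrder τ) (e : σ → τ →₀ ℕ)
    {C : Set (σ →₀ ℕ)} (hinj : Set.InjOn (Finsupp.linearCombination ℕ e) C)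
    {I : Ideal (MvPolynomial σ K)} (hI : ∀ p ∈ I, monomialHom K e p = 0)
    (hred : ∀ p, ∃ q ∈ I, ∃ r : MvPolynomial σ K, p = q + r ∧ ∀ u ∈ r.support, u ∈ C)
    {g : MvPolynomial σ K} {w : σ →₀ ℕ} (hg : monomialHom K e g ≠ 0)
    (hw : m.degree (monomialHom K e g) = Finsupp.linearCombination ℕ e w)
    (hC : ∀ u ∈ C, u + w ∈ C) {r : MvPolynomial σ K} (hr : r ∈ I ⊔ Ideal.span {g})
    (hrC : ∀ u ∈ r.support, u ∈ C) (hrw : ∀ u ∈ r.support, ¬ w ≤ u) : r = 0 := by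
  by_contra hr0
  have hne : monomialHom K e r ≠ 0 := fun h => by
    obtain ⟨u, hu⟩ := support_nonempty.mpr hr0
    have := coeff_monomialHom (hinj.mono fun u hu => hrC u hu) hu
    rw [h, coeff_zero] at this
    exact mem_support_iff.mp hu this.symm
  obtain ⟨p, hp, q, hq, rfl⟩ := Submodule.mem_sup.mp hr
  obtain ⟨a, rfl⟩ := Ideal.mem_span_singleton'.mp hq
  -- Only the class of the cofactor modulo `I` affects the image, so it may be replaced by `c`,
  -- supported in `C`.
  obtain ⟨b, hb, c, rfl, hc⟩ := hred a
  have himg : monomialHom K e (p + (b + c) * g) = monomialHom K e c * monomialHom K e g := by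
    rw [map_add, map_mul, map_add, hI p hp, hI b hb, zero_add, zero_add]
  have hc0 : monomialHom K e c ≠ 0 := fun h => hne (by rw [himg, h, zero_mul])
  obtain ⟨u, hu, hue⟩ := exists_of_mem_support_monomialHom (m.degree_mem_support hc0)
  obtain ⟨v, hv, hve⟩ := exists_of_mem_support_monomialHom (m.degree_mem_support hne)
  rw [himg, m.degree_mul hc0 hg, ← hue, hw, ← map_add] at hve
  have := hinj (hrC v hv) (hC u (hc u hu)) hve
  exact hrw v hv (this ▸ le_add_self)

/-- Serves both for `g` under grevlex and for its Segre image under lex. -/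
theorem degree_sum_monomial_sub_one [Fintype ι] [DecidableEq ι] (m : MonomialOrder τ)
    {e : ι → τ →₀ ℕ} {i₀ : ι} (h : ∀ i ≠ i₀, e i ≺[m] e i₀) (h0 : 0 ≺[m] e i₀) :
    m.degree (∑ i, monomial (e i) (1 : K) - 1) = e i₀ ∧
      m.leadingCoeff (∑ i, monomial (e i) (1 : K) - 1) = 1 := by
  classical
  have hd : m.degree (monomial (e i₀) (1 : K)) = e i₀ := by
    rw [m.degree_monomial, if_neg one_ne_zero]
  have hlt : m.degree (∑ i ∈ Finset.univ.erase i₀, monomial (e i) (1 : K) - 1) ≺[m]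
      m.degree (monomial (e i₀) (1 : K)) := by
    rw [hd, m.degree_lt_iff h0]
    intro c hc
    rcases Finset.mem_union.mp (support_sub τ _ _ hc) with hc | hc
    · obtain ⟨i, hi, hc⟩ := Finset.mem_biUnion.mp (support_sum hc)
      rw [Finset.mem_singleton.mp (support_monomial_subset hc)]
      exact h i (Finset.ne_of_mem_erase hi)
    · rw [Finset.mem_singleton.mp (support_monomial_subset hc)]
      exact h0
  rw [← Finset.add_sum_erase _ _ (Finset.mem_univ i₀), add_sub_assoc,
    m.degree_add_of_lt hlt, m.leadingCoeff_add_of_lt hlt, hd, m.leadingCoeff_monomial]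
  exact ⟨rfl, rfl⟩

/-- Existence of remainders is plain division with monic divisors; it needs no Gröbner property. -/
theorem exists_mem_span_add (m : MonomialOrder σ) {B : Set (MvPolynomial σ K)}
    (hB : ∀ b ∈ B, m.leadingCoeff b = 1) (p : MvPolynomial σ K) :
    ∃ q ∈ Ideal.span B, ∃ r : MvPolynomial σ K, p = q + r ∧
      ∀ u ∈ r.support, ∀ b ∈ B, ¬ m.degree b ≤ u := by
  obtain ⟨c, r, hp, -, hr⟩ := m.div_set (fun b hb => by rw [hB b hb]; exact isUnit_one) p
  refine ⟨_, ?_, r, hp, hr⟩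
  rw [Finsupp.linearCombination_apply]
  exact Ideal.sum_mem _ fun b _ => Ideal.mul_mem_left _ _ (Ideal.subset_span b.2)

end Toric

namespace TensorIdeal

variable {d : ℕ} {n : Fin d → ℕ}

/-! ### Description of the generators -/

theorem f_comm (α β : Index n) : f α β = f β α := by
  rw [f, f, inf_comm, sup_comm, mul_comm (x α)]

theorem f_eq (α β : Index n) :
    f α β = -monomial (Finsupp.single (toLex (α ⊓ β)) 1 + Finsupp.single (toLex (α ⊔ β)) 1) 1 +
      monomial (Finsupp.single (toLex α) 1 + Finsupp.single (toLex β) 1) 1 := by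
  simp [f, x, X, monomial_mul]

theorem g_eq : g n = ∑ α : Index n, monomial (Finsupp.single (toLex α) 2) 1 - 1 := by
  simp [g, x, X_pow_eq_monomial]

/-- The binomials of the incomparable pairs of indices. -/
def incomparableBinomials (n : Fin d → ℕ) : Set (PolyRing n) :=
  {q | ∃ α β : Index n, ¬ α ≤ β ∧ ¬ β ≤ α ∧ q = f α β}

theorem not_le_of_mem_switchSets {S M : Finset (Fin d)} (hS : 2 ≤ S.card) (hM : M ∈ switchSets S)
    {α β : Index n} (h : (α, β) ∈ pairs n S M) : ¬ α ≤ β ∧ ¬ β ≤ α := by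
  have key : M ⊆ S ∧ M.card < S.card ∧ M.Nonempty := by
    unfold switchSets at hM
    split_ifs at hM with ho
    · obtain ⟨⟨h1, h2⟩, h3⟩ := hM
      exact ⟨h1, by omega, Finset.nonempty_iff_ne_empty.mpr h3⟩
    · obtain ⟨⟨h1, h2⟩ | ⟨h1, h2, -⟩, h3⟩ := hM
      · exact ⟨h1, by omega, Finset.nonempty_iff_ne_empty.mpr h3⟩
      · exact ⟨h1, by omega, Finset.nonempty_iff_ne_empty.mpr h3⟩
  obtain ⟨h1, h2, j, hj⟩ := key
  obtain ⟨k, hk, hkM⟩ := Finset.exists_mem_notMem_of_card_lt_card h2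
  obtain ⟨-, h3, h4⟩ := h
  exact ⟨fun hle => (h3 j hj).not_ge (hle j),
    fun hle => (h4 k (Finset.mem_sdiff.mpr ⟨hk, hkM⟩)).not_ge (hle k)⟩

/-- The smaller of `M` and `S \ M` qualifies; a tie is broken by the least element of `S`. -/
theorem mem_switchSets_or_sdiff_mem {S M : Finset (Fin d)} (hMS : M ⊆ S) (hM : M.Nonempty)
    (hM' : (S \ M).Nonempty) : M ∈ switchSets S ∨ S \ M ∈ switchSets S := by
  have hcard := Finset.card_sdiff_add_card_eq_card hMS
  have h1 := hM.card_pos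
  have h2 := hM'.card_pos
  have hsub : S \ M ⊆ S := Finset.sdiff_subset
  unfold switchSets
  split_ifs with ho
  · obtain ⟨k, hk⟩ := ho
    rcases le_or_gt M.card (S.card / 2) with h | h
    · exact Or.inl ⟨⟨hMS, h⟩, hM.ne_empty⟩
    · exact Or.inr ⟨⟨hsub, by omega⟩, hM'.ne_empty⟩
  · obtain ⟨k, hk⟩ := Nat.not_odd_iff_even.mp ho
    rcases lt_trichotomy M.card (S.card / 2) with h | h | h
    · exact Or.inl ⟨Or.inl ⟨hMS, by omega⟩, hM.ne_empty⟩
    · have hS : S.Nonempty := hM.mono hMS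
      have hleast : IsLeast (S : Set (Fin d)) (S.min' hS) := S.isLeast_min' hS
      by_cases hm : S.min' hS ∈ M
      · exact Or.inl ⟨Or.inr ⟨hMS, h, _, hm, hleast⟩, hM.ne_empty⟩
      · exact Or.inr ⟨Or.inr ⟨hsub, by omega, _,
          Finset.mem_sdiff.mpr ⟨S.min'_mem hS, hm⟩, hleast⟩, hM'.ne_empty⟩
    · exact Or.inr ⟨Or.inl ⟨hsub, by omega⟩, hM'.ne_empty⟩

/-- For an incomparable pair, `S` is where the entries differ and `M` where `α` is larger. Replacing
`M` by `S \ M` swaps `α` and `β`, which leaves `f` unchanged. -/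
theorem G_eq : G n = incomparableBinomials n ∪ {g n} := by
  rw [G]
  congr 1
  ext q
  simp only [binomials, Set.mem_iUnion, incomparableBinomials, Set.mem_ofPred_eq]
  constructor
  · rintro ⟨S, hS, M, hM, ⟨α, β⟩, hp, rfl⟩
    obtain ⟨h1, h2⟩ := not_le_of_mem_switchSets hS.1 hM hp
    exact ⟨α, β, h1, h2, rfl⟩
  · rintro ⟨α, β, h1, h2, rfl⟩
    set S : Finset (Fin d) := {i | α i ≠ β i} with hS
    set M : Finset (Fin d) := {i | β i < α i} with hM
    have hMS : M ⊆ S := fun i hi => by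
      simp only [hM, hS, Finset.mem_filter_univ] at hi ⊢
      exact hi.ne'
    have hsd : ∀ i, i ∈ S \ M ↔ α i < β i := fun i => by
      simp only [hM, hS, Finset.mem_sdiff, Finset.mem_filter_univ, not_lt]
      exact ⟨fun h => lt_of_le_of_ne h.2 h.1, fun h => ⟨h.ne, h.le⟩⟩
    have hdiff : S \ (S \ M) = M := Finset.sdiff_sdiff_eq_self hMS
    obtain ⟨j, hj⟩ : ∃ j, β j < α j := by simpa [Pi.le_def] using h1
    obtain ⟨k, hk⟩ : ∃ k, α k < β k := by simpa [Pi.le_def] using h2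
    have hMne : M.Nonempty := ⟨j, by simpa [hM] using hj⟩
    have hMne' : (S \ M).Nonempty := ⟨k, (hsd k).mpr hk⟩
    have hSd : S ∈ diffSets d := by
      have := Finset.card_sdiff_add_card_eq_card hMS
      have := hMne.card_pos
      have := hMne'.card_pos
      exact ⟨by omega, by simpa using S.card_le_univ⟩
    refine ⟨S, hSd, ?_⟩
    rcases mem_switchSets_or_sdiff_mem hMS hMne hMne' with h | h
    · refine ⟨M, h, (α, β), ⟨fun i hi => ?_, fun i hi => ?_, fun i hi => (hsd i).mp hi⟩, rfl⟩
      · simpa [hS] using hi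
      · simpa [hM] using hi
    · refine ⟨S \ M, h, (β, α), ⟨fun i hi => ?_, fun i hi => (hsd i).mp hi, fun i hi => ?_⟩,
        f_comm α β⟩
      · exact Eq.symm (by simpa [hS] using hi)
      · rw [hdiff] at hi
        simpa [hM] using hi

theorem finite_G : (G n).Finite := by
  rw [G_eq]
  refine Set.Finite.union ?_ (Set.finite_singleton _)
  refine (Set.finite_range fun p : Index n × Index n => f p.1 p.2).subset ?_
  rintro _ ⟨α, β, -, -, rfl⟩
  exact ⟨(α, β), rfl⟩

/-! ### Leading monomials -/

/-- Lex extends the entrywise order, so `x_{α ∨ β}` is the smallest of the four variables. It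
divides only one of the two monomials, and grevlex makes that one the smaller. -/
theorem degree_inf_sup_lt {α β : Index n} (h1 : ¬ α ≤ β) (h2 : ¬ β ≤ α) :
    (Finsupp.single (toLex (α ⊓ β)) 1 + Finsupp.single (toLex (α ⊔ β)) 1 : VarIndex n →₀ ℕ)
      ≺[grevlex (VarIndex n)] Finsupp.single (toLex α) 1 + Finsupp.single (toLex β) 1 := by
  rw [grevlex_lt_iff]
  refine Or.inr ⟨by simp [Finsupp.degree_single], toLex (α ⊔ β), ?_, fun t ht => ?_⟩
  · have e1 : toLex α ≠ toLex (α ⊔ β) := fun h => h2 (sup_eq_left.mp (toLex_inj.mp h).symm)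
    have e2 : toLex β ≠ toLex (α ⊔ β) := fun h => h1 (sup_eq_right.mp (toLex_inj.mp h).symm)
    simp only [Finsupp.add_apply, Finsupp.single_apply, if_neg e1, if_neg e2, if_true]
    split_ifs <;> norm_num
  · have e1 : toLex α ≠ t := ((Pi.toLex_monotone (le_sup_left : α ≤ α ⊔ β)).trans_lt ht).ne
    have e2 : toLex β ≠ t := ((Pi.toLex_monotone (le_sup_right : β ≤ α ⊔ β)).trans_lt ht).ne
    have e3 : toLex (α ⊓ β) ≠ t :=
      ((Pi.toLex_monotone (inf_le_sup : α ⊓ β ≤ α ⊔ β)).trans_lt ht).ne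
    simp [e1, e2, e3, ht.ne]

theorem degree_f {α β : Index n} (h1 : ¬ α ≤ β) (h2 : ¬ β ≤ α) :
    (grevlex (VarIndex n)).degree (f α β) =
        Finsupp.single (toLex α) 1 + Finsupp.single (toLex β) 1 ∧
      (grevlex (VarIndex n)).leadingCoeff (f α β) = 1 := by
  classical
  have hlt := degree_inf_sup_lt h1 h2
  have hlt' : (grevlex (VarIndex n)).degree (-monomial (Finsupp.single (toLex (α ⊓ β)) 1 +
      Finsupp.single (toLex (α ⊔ β)) 1) (1 : ℝ)) ≺[grevlex (VarIndex n)]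
      (grevlex (VarIndex n)).degree
        (monomial (Finsupp.single (toLex α) 1 + Finsupp.single (toLex β) 1) (1 : ℝ)) := by
    rwa [MonomialOrder.degree_neg, MonomialOrder.degree_monomial, MonomialOrder.degree_monomial,
      if_neg one_ne_zero, if_neg one_ne_zero]
  rw [f_eq, add_comm, MonomialOrder.degree_add_of_lt hlt',
    MonomialOrder.leadingCoeff_add_of_lt hlt', MonomialOrder.leadingCoeff_monomial,
    MonomialOrder.degree_monomial, if_neg one_ne_zero]
  exact ⟨rfl, rfl⟩

theorem degree_g {o : Index n} (ho : ∀ α, o ≤ α) :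
    (grevlex (VarIndex n)).degree (g n) = Finsupp.single (toLex o) 2 ∧
      (grevlex (VarIndex n)).leadingCoeff (g n) = 1 := by
  rw [g_eq]
  refine degree_sum_monomial_sub_one _ (e := fun α : Index n => Finsupp.single (toLex α) 2)
    (fun α hα => ?_) ?_
  · rw [grevlex_lt_iff]
    have hlt : toLex o < toLex α :=
      lt_of_le_of_ne (Pi.toLex_monotone (ho α)) fun h => hα (toLex_inj.mp h).symm
    refine Or.inr ⟨by simp [Finsupp.degree_single], toLex α, ?_, fun t ht => ?_⟩
    · simp [hlt.ne]
    · simp [ht.ne, (hlt.trans ht).ne]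
  · rw [grevlex_lt_iff]
    exact Or.inl (by simp [Finsupp.degree_single])

theorem leadingCoeff_incomparableBinomials {q : PolyRing n} (hq : q ∈ incomparableBinomials n) :
    (grevlex (VarIndex n)).leadingCoeff q = 1 := by
  obtain ⟨α, β, h1, h2, rfl⟩ := hq
  exact (degree_f h1 h2).2

/-! ### Chains of indices and the Segre map -/

/-- The exponents whose support is a chain for the entrywise order. -/
def chains (n : Fin d → ℕ) : Set (VarIndex n →₀ ℕ) :=
  {u | ∀ a ∈ u.support, ∀ b ∈ u.support, ofLex a ≤ ofLex b ∨ ofLex b ≤ ofLex a}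

theorem mem_chains_of_forall_not_le {u : VarIndex n →₀ ℕ}
    (h : ∀ q ∈ incomparableBinomials n, ¬ (grevlex (VarIndex n)).degree q ≤ u) :
    u ∈ chains n := by
  intro a ha b hb
  by_contra! hab
  refine h _ ⟨ofLex a, ofLex b, hab.1, hab.2, rfl⟩ ?_
  rw [(degree_f hab.1 hab.2).1]
  intro c
  have hne : a ≠ b := fun h => hab.1 (by rw [h])
  have ha' := Nat.pos_of_ne_zero (Finsupp.mem_support_iff.mp ha)
  have hb' := Nat.pos_of_ne_zero (Finsupp.mem_support_iff.mp hb)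
  simp only [toLex_ofLex, Finsupp.add_apply, Finsupp.single_apply]
  split_ifs with e1 e2 e2
  · exact absurd (e1.trans e2.symm) hne
  · subst e1; omega
  · subst e2; omega
  · omega

/-- The variables of the target of the Segre map: one for each value of each coordinate, and one
that records the degree. -/
abbrev SegreIndex (n : Fin d → ℕ) := WithTop (Σₗ i, Fin (n i))

/-- The variable for the value `k` of coordinate `i`. -/
def segreIndex (i : Fin d) (k : Fin (n i)) : SegreIndex n := WithTop.some (toLex ⟨i, k⟩)

/-- The exponent of the image of `x_α` under the Segre map. -/
noncomputable def segreExp (a : VarIndex n) : SegreIndex n →₀ ℕ :=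
  Finsupp.single ⊤ 1 + ∑ i, Finsupp.single (segreIndex i (ofLex a i)) 1

theorem segreIndex_inj {i : Fin d} {k l : Fin (n i)} :
    segreIndex i k = segreIndex i l ↔ k = l := by
  simp [segreIndex, WithTop.coe_inj]

theorem segreIndex_ne {i j : Fin d} (h : i ≠ j) (k : Fin (n i)) (l : Fin (n j)) :
    segreIndex i k ≠ segreIndex j l := by
  intro e
  exact h (congrArg (fun p => (ofLex p).1) (WithTop.coe_inj.mp e))

theorem segreExp_apply_top (a : VarIndex n) : segreExp a ⊤ = 1 := by
  simp [segreExp, segreIndex]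

theorem segreExp_apply (a : VarIndex n) (i : Fin d) (k : Fin (n i)) :
    segreExp a (segreIndex i k) = if ofLex a i = k then 1 else 0 := by
  rw [segreExp, Finsupp.add_apply, Finsupp.finsetSum_apply, Finset.sum_eq_single i]
  · rw [Finsupp.single_apply, Finsupp.single_apply, if_neg (by simp [segreIndex]), zero_add]
    simp only [segreIndex_inj]
  · intro j _ hj
    rw [Finsupp.single_apply, if_neg (segreIndex_ne hj _ _)]
  · simp

/-- Exponents are natural numbers and cannot cancel, so the image records which values each
coordinate takes on the support. -/
theorem linearCombination_segreExp_ne_zero_iff (u : VarIndex n →₀ ℕ) (i : Fin d) (k : Fin (n i)) :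
    Finsupp.linearCombination ℕ segreExp u (segreIndex i k) ≠ 0 ↔
      ∃ a ∈ u.support, ofLex a i = k := by
  rw [Finsupp.linearCombination_apply, Finsupp.sum, Finsupp.finsetSum_apply, ne_eq,
    Finset.sum_eq_zero_iff]
  push Not
  refine exists_congr fun a => and_congr_right fun ha => ?_
  rw [Finsupp.mem_support_iff] at ha
  rw [Finsupp.smul_apply, segreExp_apply]
  by_cases h : ofLex a i = k
  · simp only [if_pos h, smul_eq_mul, mul_one]
    exact iff_of_true ha h
  · simp only [if_neg h, smul_eq_mul, mul_zero]
    exact iff_of_false (fun h0 => h0 rfl) h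

theorem linearCombination_segreExp_top (u : VarIndex n →₀ ℕ) :
    Finsupp.linearCombination ℕ segreExp u ⊤ = u.degree := by
  simp [Finsupp.linearCombination_apply, Finsupp.sum, Finsupp.finsetSum_apply,
    segreExp_apply_top, Finsupp.degree_apply]

/-- On a chain, the lex maximum is also the entrywise maximum. -/
theorem exists_greatest_of_mem_chains {u : VarIndex n →₀ ℕ} (hu : u ∈ chains n) (h0 : u ≠ 0) :
    ∃ a ∈ u.support, ∀ b ∈ u.support, ofLex b ≤ ofLex a := by
  have hne := Finsupp.support_nonempty_iff.mpr h0
  refine ⟨u.support.max' hne, u.support.max'_mem hne, fun b hb => ?_⟩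
  rcases hu b hb _ (u.support.max'_mem hne) with h | h
  · exact h
  · exact (congrArg ofLex (le_antisymm (u.support.le_max' b hb) (Pi.toLex_monotone h))).le

theorem chains_of_add {u v : VarIndex n →₀ ℕ} (h : u + v ∈ chains n) : u ∈ chains n :=
  fun a ha b hb => h a (Finsupp.support_mono le_self_add ha) b
    (Finsupp.support_mono le_self_add hb)

theorem apply_le_of_linearCombination_eq {u v : VarIndex n →₀ ℕ}
    (h : Finsupp.linearCombination ℕ segreExp u = Finsupp.linearCombination ℕ segreExp v)
    {a b : VarIndex n} (ha : a ∈ u.support) (hb : ∀ c ∈ v.support, ofLex c ≤ ofLex b) :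
    ofLex a ≤ ofLex b := by
  intro i
  have := (linearCombination_segreExp_ne_zero_iff u i _).mpr ⟨a, ha, rfl⟩
  rw [h, linearCombination_segreExp_ne_zero_iff] at this
  obtain ⟨c, hc, hca⟩ := this
  exact hca ▸ hb c hc i

/-- The greatest index of a chain can be read off the image coordinate by coordinate, as the largest
value occurring. Strip it off and induct on the degree, which the variable `⊤` records. -/
theorem injOn_linearCombination_segreExp :
    Set.InjOn (Finsupp.linearCombination ℕ (segreExp (n := n))) (chains n) := by
  have key : ∀ (N : ℕ) (u v : VarIndex n →₀ ℕ), u.degree = N → u ∈ chains n → v ∈ chains n →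
      Finsupp.linearCombination ℕ segreExp u = Finsupp.linearCombination ℕ segreExp v →
      u = v := by
    intro N
    induction N with
    | zero =>
      intro u v hN _ _ h
      have hv := linearCombination_segreExp_top v
      rw [← h, linearCombination_segreExp_top, hN] at hv
      rw [(Finsupp.degree_eq_zero_iff u).mp hN, (Finsupp.degree_eq_zero_iff v).mp hv.symm]
    | succ N ih =>
      intro u v hN hu hv h
      have hvN := linearCombination_segreExp_top v
      rw [← h, linearCombination_segreExp_top, hN] at hvN
      have hu0 : u ≠ 0 := by rintro rfl; simp at hN
      have hv0 : v ≠ 0 := by rintro rfl; simp at hvN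
      obtain ⟨a, ha, hau⟩ := exists_greatest_of_mem_chains hu hu0
      obtain ⟨b, hb, hbv⟩ := exists_greatest_of_mem_chains hv hv0
      obtain rfl : a = b := ofLex_inj.mp (le_antisymm
        (apply_le_of_linearCombination_eq h ha hbv) (apply_le_of_linearCombination_eq h.symm hb hau))
      have hle : ∀ {w : VarIndex n →₀ ℕ}, a ∈ w.support → Finsupp.single a 1 ≤ w := fun hw =>
        Finsupp.single_le_iff.mpr (Nat.pos_of_ne_zero (Finsupp.mem_support_iff.mp hw))
      obtain ⟨u, rfl⟩ := exists_add_of_le (hle ha)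
      obtain ⟨v, rfl⟩ := exists_add_of_le (hle hb)
      rw [map_add, map_add] at h
      rw [add_comm] at hu hv
      rw [map_add, Finsupp.degree_single] at hN
      rw [ih u v (by omega) (chains_of_add hu) (chains_of_add hv) (add_left_cancel h)]
  exact fun u hu v hv h => key _ u v rfl hu hv h

/-- In each coordinate, the minimum and maximum are the two original entries, possibly swapped. -/
theorem segreExp_inf_add_segreExp_sup (α β : Index n) :
    segreExp (toLex (α ⊓ β)) + segreExp (toLex (α ⊔ β)) =
      segreExp (toLex α) + segreExp (toLex β) := by
  simp only [segreExp, ofLex_toLex, Pi.inf_apply, Pi.sup_apply]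
  rw [add_add_add_comm, add_add_add_comm (Finsupp.single ⊤ 1) (∑ i, _), ← Finset.sum_add_distrib, ← Finset.sum_add_distrib]
  congr 1
  refine Finset.sum_congr rfl fun i _ => ?_
  rcases le_total (α i) (β i) with h | h
  · rw [inf_eq_left.mpr h, sup_eq_right.mpr h]
  · rw [inf_eq_right.mpr h, sup_eq_left.mpr h, add_comm]

theorem monomialHom_segreExp_f (α β : Index n) : monomialHom ℝ segreExp (f α β) = 0 := by
  rw [f_eq, map_add, map_neg, monomialHom_monomial, monomialHom_monomial]
  simp only [map_add, Finsupp.linearCombination_single, one_smul]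
  rw [segreExp_inf_add_segreExp_sup, neg_add_cancel]

theorem monomialHom_segreExp_of_mem_span {p : PolyRing n}
    (hp : p ∈ Ideal.span (incomparableBinomials n)) : monomialHom ℝ segreExp p = 0 := by
  have : Ideal.span (incomparableBinomials n) ≤ RingHom.ker (monomialHom ℝ (segreExp (n := n))) := by
    rw [Ideal.span_le]
    rintro _ ⟨α, β, -, -, rfl⟩
    exact monomialHom_segreExp_f α β
  exact this hp

/-! ### The leading monomial of the Segre image of `g`. -/

theorem segreExp_lt {o : Index n} (ho : ∀ α, o ≤ α) {α : Index n} (hα : α ≠ o) :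
    segreExp (toLex α) ≺[MonomialOrder.lex] segreExp (toLex o) := by
  rw [MonomialOrder.lex_lt_iff, Finsupp.Lex.lt_iff]
  obtain ⟨j, hj⟩ := Function.ne_iff.mp hα
  let s : Finset (Fin d) := {i | α i ≠ o i}
  have hs : s.Nonempty := ⟨j, by simpa [s] using hj⟩
  have hi : α (s.min' hs) ≠ o (s.min' hs) := by
    have := s.min'_mem hs
    rwa [Finset.mem_filter_univ] at this
  generalize hmin : s.min' hs = i at hi
  have hlt : ∀ k < i, α k = o k := fun k hk => by
    by_contra hne
    exact (s.min'_le k (by simpa [s] using hne)).not_gt (hmin ▸ hk)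
  -- Smaller variables weigh more in lex. At the first coordinate `i` where `α` and `o` differ, no
  -- value precedes `o i`, so this variable decides.
  refine ⟨segreIndex i (o i), fun t ht => ?_, ?_⟩
  · induction t using WithTop.recTopCoe with
    | top => exact absurd ht (by simp [segreIndex])
    | coe t =>
      obtain ⟨k, l⟩ := t
      change segreExp (toLex α) (segreIndex k l) = segreExp (toLex o) (segreIndex k l)
      have ht' := WithTop.coe_lt_coe.mp ht
      rw [segreExp_apply, segreExp_apply, ofLex_toLex, ofLex_toLex]
      rcases Sigma.Lex.lt_def.mp ht' with h | ⟨h, h'⟩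
      · rw [hlt k h]
      · obtain rfl : k = i := h
        exact absurd (ho (Function.update o k l) k)
          (by rw [Function.update_self]; exact not_le_of_gt h')
  · change segreExp (toLex α) (segreIndex i (o i)) < segreExp (toLex o) (segreIndex i (o i))
    rw [segreExp_apply, segreExp_apply]
    simp [hi]

theorem degree_monomialHom_segreExp_g {o : Index n} (ho : ∀ α, o ≤ α) :
    MonomialOrder.lex.degree (monomialHom ℝ segreExp (g n)) =
        Finsupp.linearCombination ℕ segreExp (Finsupp.single (toLex o) 2) ∧
      monomialHom ℝ segreExp (g n) ≠ 0 := by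
  have hg : monomialHom ℝ segreExp (g n) = ∑ α : Index n, monomial (2 • segreExp (toLex α)) 1 - 1 := by
    rw [g_eq, map_sub, map_sum, map_one]
    simp_rw [monomialHom_monomial, Finsupp.linearCombination_single]
  rw [hg, Finsupp.linearCombination_single]
  obtain ⟨h1, h2⟩ := degree_sum_monomial_sub_one (K := ℝ) MonomialOrder.lex
    (e := fun α : Index n => 2 • segreExp (toLex α)) (i₀ := o)
    (fun α hα => by
      have := segreExp_lt ho hα
      rw [map_nsmul, map_nsmul, two_nsmul, two_nsmul]
      exact add_lt_add this this)
    (by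
      rw [map_zero, MonomialOrder.toSyn_lt_iff_ne_zero, map_ne_zero_iff _ (AddEquiv.injective _)]
      intro h
      -- The degree variable keeps the exponent nonzero even when `d = 0`.
      have := DFunLike.congr_fun h ⊤
      simp [segreExp_apply_top] at this)
  refine ⟨h1, fun h => ?_⟩
  rw [h, MonomialOrder.leadingCoeff_zero] at h2
  exact zero_ne_one h2

theorem chains_add_single {o : Index n} (ho : ∀ α, o ≤ α) {u : VarIndex n →₀ ℕ}
    (hu : u ∈ chains n) (k : ℕ) : u + Finsupp.single (toLex o) k ∈ chains n := by
  have key : ∀ a ∈ (u + Finsupp.single (toLex o) k).support, a ∈ u.support ∨ a = toLex o := by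
    intro a ha
    by_contra! h
    rw [Finsupp.mem_support_iff, Finsupp.add_apply, Finsupp.single_apply, if_neg h.2.symm,
      Finsupp.notMem_support_iff.mp h.1] at ha
    exact ha rfl
  intro a ha b hb
  rcases key a ha with ha | rfl
  · rcases key b hb with hb | rfl
    · exact hu a ha b hb
    · exact Or.inr (ho _)
  · exact Or.inl (ho _)

/-! ### The reduced Gröbner basis -/

theorem eq_zero_of_mem_J {o : Index n} (ho : ∀ α, o ≤ α) {r : PolyRing n} (hr : r ∈ J n)
    (h : ∀ u ∈ r.support, ∀ q ∈ G n, ¬ (grevlex (VarIndex n)).degree q ≤ u) : r = 0 := by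
  rw [J, G_eq, Ideal.span_union] at hr
  rw [G_eq] at h
  obtain ⟨hdeg, hne⟩ := degree_monomialHom_segreExp_g ho
  refine eq_zero_of_mem_sup_span_singleton MonomialOrder.lex segreExp
    injOn_linearCombination_segreExp (fun p hp => monomialHom_segreExp_of_mem_span hp)
    (fun p => ?_) hne hdeg (fun u hu => chains_add_single ho hu 2) hr
    (fun u hu => mem_chains_of_forall_not_le fun q hq => h u hu q (Or.inl hq))
    (fun u hu => (degree_g ho).1 ▸ h u hu (g n) (Or.inr rfl))
  obtain ⟨q, hq, r, hp, hr⟩ := exists_mem_span_add (grevlex (VarIndex n))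
    (fun b hb => leadingCoeff_incomparableBinomials hb) p
  exact ⟨q, hq, r, hp, fun u hu => mem_chains_of_forall_not_le (hr u hu)⟩

theorem leadingCoeff_of_mem_G {o : Index n} (ho : ∀ α, o ≤ α) {q : PolyRing n} (hq : q ∈ G n) :
    (grevlex (VarIndex n)).leadingCoeff q = 1 := by
  rw [G_eq] at hq
  rcases hq with hq | rfl
  · exact leadingCoeff_incomparableBinomials hq
  · exact (degree_g ho).2

/-! ### Monomials of the generators and mutual reducedness. -/

theorem mem_support_f {α β : Index n} {u : VarIndex n →₀ ℕ} (hu : u ∈ (f α β).support) :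
    u = Finsupp.single (toLex (α ⊓ β)) 1 + Finsupp.single (toLex (α ⊔ β)) 1 ∨
      u = Finsupp.single (toLex α) 1 + Finsupp.single (toLex β) 1 := by
  classical
  rw [f_eq] at hu
  rcases Finset.mem_union.mp (support_add hu) with hu | hu
  · rw [support_neg] at hu
    exact Or.inl (Finset.mem_singleton.mp (support_monomial_subset hu))
  · exact Or.inr (Finset.mem_singleton.mp (support_monomial_subset hu))

theorem mem_support_g {u : VarIndex n →₀ ℕ} (hu : u ∈ (g n).support) :
    (∃ a, u = Finsupp.single a 2) ∨ u = 0 := by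
  classical
  rw [g_eq] at hu
  rcases Finset.mem_union.mp (support_sub _ _ _ hu) with hu | hu
  · obtain ⟨α, -, hu⟩ := Finset.mem_biUnion.mp (support_sum hu)
    exact Or.inl ⟨_, Finset.mem_singleton.mp (support_monomial_subset hu)⟩
  · exact Or.inr (Finset.mem_singleton.mp (support_monomial_subset hu))

theorem mem_pair_of_single_le {a b c : VarIndex n} {v : VarIndex n →₀ ℕ}
    (h : Finsupp.single c 1 + v ≤ Finsupp.single a 1 + Finsupp.single b 1) : c = a ∨ c = b := by
  by_contra! hc
  have := h c
  simp [hc.1.symm, hc.2.symm] at this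

theorem not_single_two_le {a b c : VarIndex n} (hab : a ≠ b) :
    ¬ Finsupp.single c 2 ≤ (Finsupp.single a 1 + Finsupp.single b 1 : VarIndex n →₀ ℕ) := by
  intro h
  have := h c
  simp only [Finsupp.add_apply, Finsupp.single_apply, if_true] at this
  split_ifs at this with h1 h2 <;> first | omega | exact hab (h1.trans h2.symm)

theorem not_degree_f_le_of_mem_support_f {α β γ δ : Index n} (h1 : ¬ α ≤ β) (h2 : ¬ β ≤ α)
    (hne : f α β ≠ f γ δ) {u : VarIndex n →₀ ℕ} (hu : u ∈ (f γ δ).support) :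
    ¬ (grevlex (VarIndex n)).degree (f α β) ≤ u := by
  rw [(degree_f h1 h2).1]
  intro h
  have h' := h
  rw [add_comm (Finsupp.single (toLex α) 1)] at h'
  rcases mem_support_f hu with rfl | rfl
  · have ha := mem_pair_of_single_le h
    have hb := mem_pair_of_single_le h'
    simp only [toLex_inj] at ha hb
    -- The indices of the trailing monomial are comparable, so they cannot be the incomparable pair
    -- `α`, `β`.
    have := inf_le_sup (a := γ) (b := δ)
    rcases ha with rfl | rfl <;> rcases hb with rfl | rfl <;> simp_all
  · have ha := mem_pair_of_single_le h
    have hb := mem_pair_of_single_le h'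
    simp only [toLex_inj] at ha hb
    rcases ha with rfl | rfl <;> rcases hb with rfl | rfl
    · exact h1 le_rfl
    · exact hne rfl
    · exact hne (f_comm _ _)
    · exact h1 le_rfl

theorem not_degree_f_le_of_mem_support_g {α β : Index n} (h1 : ¬ α ≤ β) (h2 : ¬ β ≤ α)
    {u : VarIndex n →₀ ℕ} (hu : u ∈ (g n).support) :
    ¬ (grevlex (VarIndex n)).degree (f α β) ≤ u := by
  rw [(degree_f h1 h2).1]
  intro h
  have ha := h (toLex α)
  have hb := h (toLex β)
  rcases mem_support_g hu with ⟨c, rfl⟩ | rfl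
  · by_cases hc : c = toLex α
    · have : c ≠ toLex β := fun e => h1 (toLex_inj.mp (hc.symm.trans e)).le
      simp [Finsupp.single_apply, this] at hb
    · simp [Finsupp.single_apply, hc] at ha
  · simp at ha

theorem not_degree_g_le_of_mem_support_f {o : Index n} (ho : ∀ α, o ≤ α) {α β : Index n}
    (h1 : ¬ α ≤ β) {u : VarIndex n →₀ ℕ} (hu : u ∈ (f α β).support) :
    ¬ (grevlex (VarIndex n)).degree (g n) ≤ u := by
  rw [(degree_g ho).1]
  rcases mem_support_f hu with rfl | rfl
  · refine not_single_two_le fun h => h1 ?_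
    exact (inf_eq_sup.mp (toLex_inj.mp h)).le
  · exact not_single_two_le fun h => h1 (toLex_inj.mp h).le

theorem isReducedGroebnerBasis {o : Index n} (ho : ∀ α, o ≤ α) :
    IsReducedGroebnerBasis (grevlex (VarIndex n)) (G n) (J n) where
  finite := finite_G
  zero_notMem h0 := by
    have := leadingCoeff_of_mem_G ho h0
    rw [MonomialOrder.leadingCoeff_zero] at this
    exact zero_ne_one this
  span_eq := rfl
  existsUnique_remainder p := by
    obtain ⟨q, hq, r, hp, hr⟩ := exists_mem_span_add (grevlex (VarIndex n))
      (fun b hb => leadingCoeff_of_mem_G ho hb) p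
    refine ⟨r, ⟨⟨q, hq, hp⟩, hr⟩, ?_⟩
    rintro r' ⟨⟨q', hq', hp'⟩, hr'⟩
    -- The difference of two remainders is a reduced element of `J n`.
    refine sub_eq_zero.mp (eq_zero_of_mem_J ho ?_ fun u hu => ?_)
    · have : r' - r = q - q' := by
        rw [sub_eq_sub_iff_add_eq_add, add_comm, ← hp', hp]
      rw [this]
      exact Ideal.sub_mem _ hq hq'
    · classical
      rcases Finset.mem_union.mp (support_sub _ _ _ hu) with hu | hu
      · exact hr' u hu
      · exact hr u hu
  leadingCoeff_eq_one _ hq := leadingCoeff_of_mem_G ho hq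
  reduced p hp q hq hne u hu := by
    rw [G_eq] at hp hq
    rcases hp with ⟨γ, δ, h1, h2, rfl⟩ | rfl <;> rcases hq with ⟨α, β, h3, h4, rfl⟩ | rfl
    · exact not_degree_f_le_of_mem_support_f h3 h4 hne hu
    · exact not_degree_g_le_of_mem_support_f ho h1 hu
    · exact not_degree_f_le_of_mem_support_g h3 h4 hu
    · exact absurd rfl hne

end TensorIdeal

theorem theorem4p5 {d : ℕ} (n : Fin d → ℕ) (hn : ∀ i, 1 ≤ n i) :
    IsReducedGroebnerBasis (grevlex (TensorIdeal.VarIndex n)) (TensorIdeal.G n)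
      (TensorIdeal.J n) :=
  -- Entries of `Fin (n i)` start at `0`, so this is the index `(1, …, 1)`.
  TensorIdeal.isReducedGroebnerBasis (o := fun i => ⟨0, hn i⟩) fun _ _ => Nat.zero_le _
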